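/- **Conventions.** Let $n\ge 1$, $[n]=\{1,\dots,n\}$, and for $w\in S_n$ let $w[k]=\{w(1),\dots,w(k)\}$. Let $\ell(w)$ be the number of inversions of $w$ and $t_{ij}$ the transposition of $i<j$. * The quantum Bruhat graph is the directed graph on $S_n$ with an edge $w\to wt_{ij}$ ($i<j$) whenever $\ell(wt_{ij})=\ell(w)+1$ or $\ell(wt_{ij})=\ell(w)+1-2(j-i)$. Let $\ell(u,v)$ be the length of a shortest directed path from $u$ to $v$. The tilted Bruhat interval is $[u,v]=\{w\in S_n:\ \ell(u,w)+\ell(w,v)=\ell(u,v)\}$. * For $r\in[n]$ let $\le_r$ be the linear order $r<_r r+1<_r\dots<_r n<_r 1<_r\dots<_r r-1$ on $[n]$. For $A=\{a_1<_r\dots<_r a_k\}$ and $B=\{b_1<_r\dots<_r b_k\}$, write $A\le_r B$ if $a_i\le_r b_i$ for all $i$. For a sequence $\mathbf a=(a_1,\dots,a_{n-1})$ in $[n]$, write $u\le_{\mathbf a}v$ if $u[k]\le_{a_k}v[k]$ for all $k\in[n-1]$. * $\mathrm{Fl}_n$ is the set of complete flags $F_\bullet=(0=F_0\subsetneq F_1\subsetneq\dots\subsetneq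 F_n=\mathbb C^n)$. For $I\subseteq[n]$ with $|I|=k$, $P_I(F_\bullet)$ is the minor in the rows $I$ of an $n\times k$ matrix whose columns form a basis of $F_k$ (well-defined up to one nonzero scalar common to all $I$ of size $k$). Put $P_w=\prod_{k=1}^{n-1}P_{w[k]}$ for $w\in S_n$. * For $S\subseteq[n]$ let $\mathrm{Proj}_S:\mathbb C^n\to\mathbb C^{S}$ be the coordinate projection. For $a,b\in[n]$ let $[a,b]_c=\{a,\dots,b\}$ if $a\le b$ and $[a,b]_c=\{a,\dots,n\}\cup\{1,\dots,b\}$ if $a>b$; also $[a,0]_c=\{a,\dots,n\}$. For $\mathbf a$ with $u\le_{\mathbf a}v$, let $\mathcal T_{u,v,\mathbf a}$ be the set of $F_\bullet\in\mathrm{Fl}_n$ with $$\dim\mathrm{Proj}_{[a_k,j]_c}(F_k)\le\#(u[k]\cap[a_k,j]_c),\qquad \dim\mathrm{Proj}_{[j,a_k-1]_c}(F_k)\le\#(v[k]\cap[j,a_k-1]_c)$$ for all $k\in[n-1]$, $j\in[n]$, and let $\mathcal T^\circ_{u,v,\mathbf a}$ be defined in the same way with both "$\le$" replaced by "$=$".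 **Theorem 4.9.** Let $u,v\in S_n$. There is a sequence $\mathbf a$ with $u\le_{\mathbf a}v$, and for every such $\mathbf a$ $$\mathcal T_{u,v,\mathbf a}=\{F_\bullet\in\mathrm{Fl}_n:\ P_w(F_\bullet)=0\text{ for all }w\in S_n\text{ with }w\notin[u,v]\},\qquad \mathcal T^\circ_{u,v,\mathbf a}=\mathcal T_{u,v,\mathbf a}\cap\{P_uP_v\ne0\}.$$ (In particular these sets do not depend on $\mathbf a$; they are the tilted Richardson variety $\mathcal T_{u,v}$ and the open tilted Richardson variety $\mathcal T^\circ_{u,v}$.) -/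

import Mathlib

/-! Conventions: the set `[n] = {1, …, n}` is `Fin n` (so `x ∈ [n]` is the element with value `x - 1`),
and the symmetric group `S_n` is `Equiv.Perm (Fin n)`, with `(w * t) i = w (t i)`. -/

namespace TiltedRichardson

/-! ### The quantum Bruhat graph and tilted Bruhat intervals -/

/-- The Coxeter length of a permutation: its number of inversions. -/
def coxeterLength {n : ℕ} (w : Equiv.Perm (Fin n)) : ℕ :=
  (Finset.univ.filter fun p : Fin n × Fin n => p.1 < p.2 ∧ w p.2 < w p.1).card

/-- The edges `w ⟶ w t_{ij}`, `i < j`, of the quantum Bruhat graph on `S_n`: those with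
`ℓ(w t_{ij}) = ℓ(w) + 1` or `ℓ(w t_{ij}) = ℓ(w) + 1 - 2 (j - i)`. -/
def QBGEdge {n : ℕ} (w w' : Equiv.Perm (Fin n)) : Prop :=
  ∃ i j : Fin n, i < j ∧ w' = w * Equiv.swap i j ∧
    (coxeterLength w' = coxeterLength w + 1 ∨
      coxeterLength w' + 2 * ((j : ℕ) - (i : ℕ)) = coxeterLength w + 1)

/-- There is a directed path of length `m` from `u` to `v` in the quantum Bruhat graph. -/
def HasQBGPath {n : ℕ} (u v : Equiv.Perm (Fin n)) (m : ℕ) : Prop :=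
  ∃ p : ℕ → Equiv.Perm (Fin n), p 0 = u ∧ p m = v ∧ ∀ i < m, QBGEdge (p i) (p (i + 1))

/-- `ℓ(u, v)`: the length of a shortest directed path from `u` to `v` in the quantum Bruhat graph
(which is strongly connected, so that such a path always exists). -/
noncomputable def qbgDist {n : ℕ} (u v : Equiv.Perm (Fin n)) : ℕ :=
  sInf {m | HasQBGPath u v m}

/-- The tilted Bruhat order `w ≤_u v`. -/
def TiltedLE {n : ℕ} (u w v : Equiv.Perm (Fin n)) : Prop :=
  qbgDist u w + qbgDist w v = qbgDist u v

/-- The tilted Bruhat interval `[u, v] = [u, v]_u`. -/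
def tiltedInterval {n : ℕ} (u v : Equiv.Perm (Fin n)) : Set (Equiv.Perm (Fin n)) :=
  {x | TiltedLE u u x ∧ TiltedLE u x v}

/-! ### Shifted Gale orders -/

/-- `w[k] = {w_1, …, w_k}`. -/
def initialSet {n : ℕ} (w : Equiv.Perm (Fin n)) (k : ℕ) : Finset (Fin n) :=
  (Finset.univ.filter fun i : Fin n => (i : ℕ) < k).image w

/-- The Gale order on subsets of `[n]` of equal size: compare the `i`-th smallest elements. -/
def GaleLE {n : ℕ} (A B : Finset (Fin n)) : Prop :=
  ∃ h : A.card = B.card, ∀ i : Fin B.card, A.orderEmbOfFin h i ≤ B.orderEmbOfFin rfl i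

/-- The shifted Gale order `A ≤_r B`. As subtraction in `Fin n` is modulo `n`, the map `x ↦ x - r`
is the order isomorphism from `[n]` with the shifted order
`r <_r r + 1 <_r ⋯ <_r n <_r 1 <_r ⋯ <_r r - 1` to `[n]` with its usual order. -/
def ShiftedGaleLE {n : ℕ} (r : Fin n) (A B : Finset (Fin n)) : Prop :=
  GaleLE (A.image fun x => x - r) (B.image fun x => x - r)

/-- `u ≤_𝐚 v` for a sequence `𝐚 = (a_1, …, a_{n-1})` in `[n]`: `u[k] ≤_{a_k} v[k]` for every
`k ∈ [n-1]`. Here and below, `i : Fin (n - 1)` stands for `k = i + 1`. -/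
def SeqLE {n : ℕ} (a : Fin (n - 1) → Fin n) (u v : Equiv.Perm (Fin n)) : Prop :=
  ∀ i : Fin (n - 1), ShiftedGaleLE (a i) (initialSet u (i + 1)) (initialSet v (i + 1))

/-! ### Complete flags and Plücker coordinates -/

/-- Points of `Fl_n`: complete flags `0 = F_0 ⊂ F_1 ⊂ ⋯ ⊂ F_n = ℂⁿ` with `dim F_k = k`. -/
@[ext]
structure CompleteFlag (n : ℕ) where
  /-- the `k`-th subspace of the flag -/
  space : Fin (n + 1) → Submodule ℂ (Fin n → ℂ)
  mono : Monotone space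
  finrank_space : ∀ k, Module.finrank ℂ (space k) = (k : ℕ)

/-- The Plücker coordinate `P_I` of the `k`-dimensional subspace `V ⊆ ℂⁿ` with respect to a
basis `b` of `V`: the minor in the rows `I`, `|I| = k`, of the `n × k` matrix with columns `b`. -/
noncomputable def pluckerOfBasis {n k : ℕ} {V : Submodule ℂ (Fin n → ℂ)}
    (b : Module.Basis (Fin k) ℂ V) (I : Finset (Fin n)) (hI : I.card = k) : ℂ :=
  Matrix.det (Matrix.of fun r c : Fin k => (b c : Fin n → ℂ) (I.orderEmbOfFin hI r))

/-- Another basis of `V` multiplies all Plücker coordinates by one nonzero scalar, so that they are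
well-defined projective coordinates of `V`, and their vanishing does not depend on the basis. -/
theorem pluckerOfBasis_change {n k : ℕ} {V : Submodule ℂ (Fin n → ℂ)}
    (b b' : Module.Basis (Fin k) ℂ V) :
    ∃ c : ℂ, c ≠ 0 ∧ ∀ (I : Finset (Fin n)) (hI : I.card = k),
      pluckerOfBasis b' I hI = c * pluckerOfBasis b I hI := by
  refine ⟨(b.toMatrix b').det, ?_, fun I hI => ?_⟩
  · have h : (b.toMatrix b').det * (b'.toMatrix b).det = 1 := by
      rw [← Matrix.det_mul, Module.Basis.toMatrix_mul_toMatrix_flip, Matrix.det_one]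
    exact left_ne_zero_of_mul_eq_one h
  · rw [pluckerOfBasis, pluckerOfBasis, mul_comm, ← Matrix.det_mul]
    congr 1
    ext r c
    have h := congrArg (fun x : V => (x : Fin n → ℂ) (I.orderEmbOfFin hI r))
      (b.sum_toMatrix_smul_self b' c)
    simp only [Submodule.coe_sum, Submodule.coe_smul, Finset.sum_apply, Pi.smul_apply,
      smul_eq_mul] at h
    simp only [Matrix.of_apply, Matrix.mul_apply]
    rw [← h]
    exact Finset.sum_congr rfl fun i _ => mul_comm _ _

/-- The Plücker coordinate `P_I(F) = P_I(F_k)`, `k = |I|`, of a flag, computed in some chosen basis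
of `F_k`; by `pluckerOfBasis_change`, the choice only matters up to a nonzero scalar that depends
on `k` alone. -/
noncomputable def CompleteFlag.plucker {n : ℕ} (F : CompleteFlag n) (I : Finset (Fin n)) : ℂ :=
  pluckerOfBasis
    (Module.finBasisOfFinrankEq ℂ
      (F.space ⟨I.card, Nat.lt_succ_of_le (card_finset_fin_le I)⟩) (F.finrank_space _)) I rfl

/-- `P_w(F) = ∏_{k=1}^{n-1} P_{w[k]}(F)`. -/
noncomputable def CompleteFlag.pluckerPerm {n : ℕ} (F : CompleteFlag n)
    (w : Equiv.Perm (Fin n)) : ℂ :=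
  ∏ i : Fin (n - 1), F.plucker (initialSet w (i + 1))

/-! ### Tilted Richardson varieties -/

/-- The cyclic interval `[a, j]_c`. -/
def cyclicIcc {n : ℕ} (a j : Fin n) : Finset (Fin n) :=
  if a ≤ j then Finset.Icc a j else Finset.Ici a ∪ Finset.Iic j

/-- The cyclic interval `[j, a - 1]_c`, which is `[j, n]` for `a = 1` and `[n]` for `j = a`. -/
def cyclicIccPred {n : ℕ} (j a : Fin n) : Finset (Fin n) :=
  if j < a then Finset.Ico j a else Finset.Ici j ∪ Finset.Iio a

/-- `dim Proj_S(V)`, for the projection `Proj_S : ℂⁿ → ℂ^S` onto the coordinates in `S`. -/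
noncomputable def projDim {n : ℕ} (S : Finset (Fin n)) (V : Submodule ℂ (Fin n → ℂ)) : ℕ :=
  Module.finrank ℂ (V.map (LinearMap.funLeft ℂ ℂ (fun x : S => (x : Fin n))))

/-- The subspace `F_k` of a flag for `k = i + 1 ∈ [n-1]`. -/
def CompleteFlag.step {n : ℕ} (F : CompleteFlag n) (i : Fin (n - 1)) :
    Submodule ℂ (Fin n → ℂ) :=
  F.space ⟨i + 1, by omega⟩

/-- The open tilted Richardson variety `𝒯°_{u,v,𝐚}` with respect to `𝐚`. -/
def openTiltedRichardson {n : ℕ} (u v : Equiv.Perm (Fin n)) (a : Fin (n - 1) → Fin n) :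
    Set (CompleteFlag n) :=
  {F | ∀ (i : Fin (n - 1)) (j : Fin n),
    projDim (cyclicIcc (a i) j) (F.step i) = (initialSet u (i + 1) ∩ cyclicIcc (a i) j).card ∧
    projDim (cyclicIccPred j (a i)) (F.step i) =
      (initialSet v (i + 1) ∩ cyclicIccPred j (a i)).card}

/-- The tilted Richardson variety `𝒯_{u,v,𝐚}` with respect to `𝐚`. -/
def tiltedRichardson {n : ℕ} (u v : Equiv.Perm (Fin n)) (a : Fin (n - 1) → Fin n) :
    Set (CompleteFlag n) :=
  {F | ∀ (i : Fin (n - 1)) (j : Fin n),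
    projDim (cyclicIcc (a i) j) (F.step i) ≤ (initialSet u (i + 1) ∩ cyclicIcc (a i) j).card ∧
    projDim (cyclicIccPred j (a i)) (F.step i) ≤
      (initialSet v (i + 1) ∩ cyclicIccPred j (a i)).card}

end TiltedRichardson

open TiltedRichardson

/-!
The combinatorial core is a formula for distances in the quantum Bruhat graph. For subsets `A`, `B`
of `[n]`, let `d(A, B)` be the maximum over `0 ≤ m ≤ n` of `#(B ∩ [m]) - #(A ∩ [m])`. Then
`ℓ(u, v) = ℓ(v) - ℓ(u) + 2 ∑ₖ d(u[k], v[k])` (`qbgDist_eq`). The right-hand side satisfies the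
triangle inequality and is at most `1` on edges, so that it bounds the lengths of paths from below.
Conversely, let `i` be the first position where `u` and `v` differ, and let `j > i` be the first
position with `u j` in the cyclic interval `(u i, v i]`. Then `u ⟶ u t_{ij}` is an edge, and it
decreases the right-hand side by `1` (`exists_edge_tiltedLength_lt`); iterating this gives a path
of the required length.

So `w ∈ [u, v]` means that `d(u[k], w[k]) + d(w[k], v[k]) = d(u[k], v[k])` for all `k`. For sets of
equal size, `A ≤_r B` means that the maximum `d(A, B)` is attained just before `r`
(`shiftedGaleLE_iff_maxExcess`). Hence some `𝐚` with `u ≤_𝐚 v` exists, and for each such `𝐚` the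
interval `[u, v]` is the set of `w` with `u ≤_𝐚 w ≤_𝐚 v` (`mem_tiltedInterval_iff_seqLE`).

On the geometric side, `P_I(F_k) ≠ 0` means that `I` is a basis of the matroid of `F_k`, and
`dim Proj_S(F_k)` is the rank of `S` in this matroid. The inequalities defining `𝒯_{u,v,𝐚}` thus say
that all bases of each `F_k` lie between `u[k]` and `v[k]` in the order `≤_{a_k}`
(`mem_tiltedRichardson_iff`). As each basis of `F_k` belongs to a chain of bases `w[1] ⊂ w[2] ⊂ ⋯`
for some permutation `w` (`CompleteFlag.exists_perm_of_isCoordBasis`), this is the condition that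
`P_w(F) ≠ 0` only for `w ∈ [u, v]`. Finally, equality in all the inequalities forces `u[k]` and
`v[k]` to be the bases of `F_k` that are extremal for `≤_{a_k}`, and is in turn implied by their
being bases.
-/

namespace TiltedRichardson

open Finset

/-! ### Inversions and transpositions -/

theorem coxeterLength_eq_sum {n : ℕ} (w : Equiv.Perm (Fin n)) :
    coxeterLength w = ∑ p, ∑ q, if p < q ∧ w q < w p then 1 else 0 := by
  rw [coxeterLength, Finset.card_filter, ← Finset.univ_product_univ, Finset.sum_product]

theorem sum_eq_add_add_sum_compl {ι M : Type*} [Fintype ι] [DecidableEq ι] [AddCommMonoid M]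
    {i j : ι} (hij : i ≠ j) (f : ι → M) :
    ∑ p, f p = f i + f j + ∑ p ∈ ({i, j} : Finset ι)ᶜ, f p := by
  rw [← Finset.sum_add_sum_compl {i, j} f, Finset.sum_pair hij]

/-- Only the pairs of positions meeting `{i, j}` contribute to the change of the number of
inversions. -/
theorem coxeterLength_mul_swap {n : ℕ} (w : Equiv.Perm (Fin n)) {i j : Fin n} (hij : i < j)
    (hw : w i < w j) :
    coxeterLength (w * Equiv.swap i j) = coxeterLength w + 1 +
      2 * (univ.filter fun p => (i < p ∧ p < j) ∧ w i < w p ∧ w p < w j).card := by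
  have hne := hij.ne
  have hfix : ∀ p ∈ ({i, j} : Finset (Fin n))ᶜ, (w * Equiv.swap i j) p = w p := by
    intro p hp
    simp only [mem_compl, mem_insert, mem_singleton, not_or] at hp
    simp [Equiv.swap_apply_of_ne_of_ne hp.1 hp.2]
  have hi : (w * Equiv.swap i j) i = w j := by simp
  have hj : (w * Equiv.swap i j) j = w i := by simp
  generalize w * Equiv.swap i j = w' at *
  have key : ∀ x : Equiv.Perm (Fin n), coxeterLength x =
      ((if x j < x i then 1 else 0) +
        ∑ p ∈ ({i, j} : Finset (Fin n))ᶜ,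
          ((if i < p ∧ x p < x i then 1 else 0) + (if j < p ∧ x p < x j then 1 else 0) +
          (if p < i ∧ x i < x p then 1 else 0) + (if p < j ∧ x j < x p then 1 else 0))) +
        ∑ p ∈ ({i, j} : Finset (Fin n))ᶜ, ∑ q ∈ ({i, j} : Finset (Fin n))ᶜ,
          if p < q ∧ x q < x p then 1 else 0 := by
    intro x
    rw [coxeterLength_eq_sum, sum_eq_add_add_sum_compl hne]
    simp only [sum_eq_add_add_sum_compl hne]
    simp only [sum_add_distrib, lt_irrefl, false_and, if_false, hij, hij.not_gt, true_and]
    ring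
  have hcard : (univ.filter fun p => (i < p ∧ p < j) ∧ w i < w p ∧ w p < w j).card =
      ∑ p ∈ ({i, j} : Finset (Fin n))ᶜ,
        if (i < p ∧ p < j) ∧ w i < w p ∧ w p < w j then 1 else 0 := by
    rw [card_filter, sum_eq_add_add_sum_compl hne]
    simp
  rw [key w', key w, hcard, hi, hj]
  have h1 : ∑ p ∈ ({i, j} : Finset (Fin n))ᶜ, ∑ q ∈ ({i, j} : Finset (Fin n))ᶜ,
      (if p < q ∧ w' q < w' p then 1 else 0) =
      ∑ p ∈ ({i, j} : Finset (Fin n))ᶜ, ∑ q ∈ ({i, j} : Finset (Fin n))ᶜ,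
      (if p < q ∧ w q < w p then 1 else 0) :=
    sum_congr rfl fun p hp => sum_congr rfl fun q hq => by rw [hfix p hp, hfix q hq]
  have h2 : ∑ p ∈ ({i, j} : Finset (Fin n))ᶜ,
          ((if i < p ∧ w' p < w j then 1 else 0) + (if j < p ∧ w' p < w i then 1 else 0) +
          (if p < i ∧ w j < w' p then 1 else 0) + (if p < j ∧ w i < w' p then 1 else 0)) =
      ∑ p ∈ ({i, j} : Finset (Fin n))ᶜ,
          ((if i < p ∧ w p < w i then 1 else 0) + (if j < p ∧ w p < w j then 1 else 0) +
          (if p < i ∧ w i < w p then 1 else 0) + (if p < j ∧ w j < w p then 1 else 0)) +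
        2 * ∑ p ∈ ({i, j} : Finset (Fin n))ᶜ,
          if (i < p ∧ p < j) ∧ w i < w p ∧ w p < w j then 1 else 0 := by
    rw [mul_sum, ← sum_add_distrib]
    refine sum_congr rfl fun p hp => ?_
    rw [hfix p hp]
    simp only [mem_compl, mem_insert, mem_singleton, not_or] at hp
    have e1 : w p ≠ w i := fun h => hp.1 (w.injective h)
    have e2 : w p ≠ w j := fun h => hp.2 (w.injective h)
    obtain ⟨hp1, hp2⟩ := hp
    simp only [Fin.lt_def, ne_eq, Fin.ext_iff] at *
    generalize (w p : ℕ) = a at *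
    generalize (w i : ℕ) = b at *
    generalize (w j : ℕ) = c at *
    rcases lt_or_gt_of_ne hp1 with h1 | h1 <;> rcases lt_or_gt_of_ne hp2 with h2 | h2 <;>
    rcases lt_or_gt_of_ne e1 with h3 | h3 <;> rcases lt_or_gt_of_ne e2 with h4 | h4 <;>
    simp [h1, h2, h3, h4, h1.not_gt, h2.not_gt, h3.not_gt, h4.not_gt] <;> omega
  rw [h1, h2, if_pos hw, if_neg hw.not_gt]
  ring

/-! ### Counting in initial intervals -/

/-- The number of elements of `A` among the first `m` elements of `[n]`. -/
def countBelow {n : ℕ} (A : Finset (Fin n)) (m : ℕ) : ℕ :=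
  (A.filter fun x : Fin n => (x : ℕ) < m).card

/-- The excess of `B` over `A` among the first `m` elements of `[n]`. -/
def excess {n : ℕ} (A B : Finset (Fin n)) (m : ℕ) : ℤ :=
  (countBelow B m : ℤ) - countBelow A m

/-- The maximal excess of `B` over `A` in an initial interval. It is nonnegative, as the empty
interval is allowed. -/
def maxExcess {n : ℕ} (A B : Finset (Fin n)) : ℤ :=
  (range (n + 1)).sup' ⟨0, by simp⟩ (excess A B)

theorem excess_le_maxExcess {n : ℕ} (A B : Finset (Fin n)) {m : ℕ} (hm : m ≤ n) :
    excess A B m ≤ maxExcess A B :=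
  le_sup' (excess A B) (by simpa [Nat.lt_succ_iff] using hm)

theorem maxExcess_le {n : ℕ} {A B : Finset (Fin n)} {c : ℤ} (h : ∀ m ≤ n, excess A B m ≤ c) :
    maxExcess A B ≤ c :=
  sup'_le _ _ fun m hm => h m (by simpa [Nat.lt_succ_iff] using hm)

theorem exists_maxExcess_eq {n : ℕ} (A B : Finset (Fin n)) :
    ∃ m ≤ n, maxExcess A B = excess A B m := by
  obtain ⟨m, hm, h⟩ := exists_mem_eq_sup' (s := range (n + 1)) ⟨0, by simp⟩ (excess A B)
  exact ⟨m, by simpa [Nat.lt_succ_iff] using hm, h⟩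

theorem excess_add {n : ℕ} (A B C : Finset (Fin n)) (m : ℕ) :
    excess A B m + excess B C m = excess A C m := by
  simp only [excess]; ring

theorem excess_zero {n : ℕ} (A B : Finset (Fin n)) : excess A B 0 = 0 := by
  simp [excess, countBelow]

theorem countBelow_self {n : ℕ} (A : Finset (Fin n)) : countBelow A n = A.card := by
  simp [countBelow]

theorem excess_self {n : ℕ} {A B : Finset (Fin n)} (h : A.card = B.card) : excess A B n = 0 := by
  simp [excess, countBelow_self, h]

theorem maxExcess_nonneg {n : ℕ} (A B : Finset (Fin n)) : 0 ≤ maxExcess A B :=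
  (excess_zero A B).symm.le.trans (excess_le_maxExcess A B n.zero_le)

theorem maxExcess_triangle {n : ℕ} (A B C : Finset (Fin n)) :
    maxExcess A C ≤ maxExcess A B + maxExcess B C :=
  maxExcess_le fun m hm => by
    rw [← excess_add A B C]
    exact add_le_add (excess_le_maxExcess _ _ hm) (excess_le_maxExcess _ _ hm)

theorem card_initialSet {n : ℕ} (w : Equiv.Perm (Fin n)) {k : ℕ} (hk : k ≤ n) :
    (initialSet w k).card = k := by
  rw [initialSet, card_image_of_injective _ w.injective]
  have : (univ.filter fun i : Fin n => (i : ℕ) < k).map Fin.valEmbedding = range k := by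
    ext x
    simp only [mem_map, mem_filter, mem_univ, true_and, Fin.valEmbedding_apply, mem_range]
    exact ⟨by rintro ⟨y, hy, rfl⟩; exact hy, fun h => ⟨⟨x, by omega⟩, h, rfl⟩⟩
  rw [← card_map, this, card_range]

theorem countBelow_initialSet {n : ℕ} (w : Equiv.Perm (Fin n)) (k m : ℕ) :
    (countBelow (initialSet w k) m : ℤ) =
      ∑ p : Fin n, if (p : ℕ) < k ∧ (w p : ℕ) < m then 1 else 0 := by
  rw [countBelow, initialSet, filter_image, card_image_of_injective _ w.injective, filter_filter,
    card_filter]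
  push_cast
  rfl

theorem excess_initialSet_mul_swap {n : ℕ} (w : Equiv.Perm (Fin n)) {i j : Fin n} (hij : i < j)
    (k m : ℕ) :
    excess (initialSet w k) (initialSet (w * Equiv.swap i j) k) m =
      if (i : ℕ) < k ∧ k ≤ j then
        (if (w j : ℕ) < m then 1 else 0) - (if (w i : ℕ) < m then 1 else 0) else 0 := by
  rw [excess, countBelow_initialSet, countBelow_initialSet, sum_eq_add_add_sum_compl hij.ne,
    sum_eq_add_add_sum_compl hij.ne]
  have : ∑ p ∈ ({i, j} : Finset (Fin n))ᶜ,
      (if (p : ℕ) < k ∧ ((w * Equiv.swap i j) p : ℕ) < m then (1 : ℤ) else 0) =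
      ∑ p ∈ ({i, j} : Finset (Fin n))ᶜ, if (p : ℕ) < k ∧ (w p : ℕ) < m then 1 else 0 := by
    refine sum_congr rfl fun p hp => ?_
    simp only [mem_compl, mem_insert, mem_singleton, not_or] at hp
    simp [Equiv.swap_apply_of_ne_of_ne hp.1 hp.2]
  rw [this]
  simp only [Equiv.Perm.mul_apply, Equiv.swap_apply_left, Equiv.swap_apply_right]
  have hij' : (i : ℕ) < j := hij
  split_ifs <;> omega

/-! ### Distances in the quantum Bruhat graph -/

/-- The number `ℓ(v) - ℓ(u) + 2 ∑ₖ dₖ(u, v)`, where `dₖ(u, v)` is the maximal excess of `v[k]` over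
`u[k]`; it is the distance from `u` to `v` in the quantum Bruhat graph, by `qbgDist_eq`. -/
def tiltedLength {n : ℕ} (u v : Equiv.Perm (Fin n)) : ℤ :=
  (coxeterLength v : ℤ) - coxeterLength u +
    2 * ∑ t : Fin (n - 1), maxExcess (initialSet u (t + 1)) (initialSet v (t + 1))

theorem tiltedLength_triangle {n : ℕ} (u w v : Equiv.Perm (Fin n)) :
    tiltedLength u v ≤ tiltedLength u w + tiltedLength w v := by
  have := sum_le_sum fun (t : Fin (n - 1)) (_ : t ∈ univ) =>
    maxExcess_triangle (initialSet u (t + 1)) (initialSet w (t + 1)) (initialSet v (t + 1))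
  rw [sum_add_distrib] at this
  simp only [tiltedLength]
  linarith

theorem sum_indicator_between {n : ℕ} {i j : Fin n} (hij : i < j) :
    ∑ t : Fin (n - 1), (if (i : ℕ) < t + 1 ∧ (t : ℕ) + 1 ≤ j then (1 : ℤ) else 0) = j - i := by
  have h : (univ.filter fun t : Fin (n - 1) => (i : ℕ) < t + 1 ∧ (t : ℕ) + 1 ≤ j).map
      Fin.valEmbedding = Ico (i : ℕ) j := by
    ext x
    simp only [mem_map, mem_filter, mem_univ, true_and, Fin.valEmbedding_apply, mem_Ico]
    exact ⟨by rintro ⟨y, hy, rfl⟩; omega, fun h => ⟨⟨x, by omega⟩, by dsimp; omega, rfl⟩⟩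
  rw [← natCast_card_filter, ← card_map, h, Nat.card_Ico, Nat.cast_sub hij.le]

theorem tiltedLength_le_one_of_edge {n : ℕ} {u x : Equiv.Perm (Fin n)} (h : QBGEdge u x) :
    tiltedLength u x ≤ 1 := by
  obtain ⟨i, j, hij, rfl, h⟩ := h
  have hij' : (i : ℕ) < j := hij
  rcases h with h | h
  · have hw : u i < u j := by
      by_contra hw
      have hw : u j < u i := lt_of_le_of_ne (not_lt.1 hw) fun e => hij.ne' (u.injective e)
      have := coxeterLength_mul_swap (u * Equiv.swap i j) hij (by simpa using hw)
      rw [mul_assoc, Equiv.swap_mul_self, mul_one] at this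
      omega
    have : ∑ t : Fin (n - 1), maxExcess (initialSet u (t + 1))
        (initialSet (u * Equiv.swap i j) (t + 1)) ≤ 0 :=
      sum_nonpos fun t _ => maxExcess_le fun m _ => by
        rw [excess_initialSet_mul_swap u hij]
        have : (u i : ℕ) < u j := hw
        split_ifs <;> omega
    simp only [tiltedLength]
    omega
  · have : ∑ t : Fin (n - 1), maxExcess (initialSet u (t + 1))
        (initialSet (u * Equiv.swap i j) (t + 1)) ≤
        ∑ t : Fin (n - 1), (if (i : ℕ) < t + 1 ∧ (t : ℕ) + 1 ≤ j then (1 : ℤ) else 0) :=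
      sum_le_sum fun t _ => maxExcess_le fun m _ => by
        rw [excess_initialSet_mul_swap u hij]
        split_ifs <;> omega
    rw [sum_indicator_between hij] at this
    simp only [tiltedLength]
    omega

theorem tiltedLength_self {n : ℕ} (u : Equiv.Perm (Fin n)) : tiltedLength u u = 0 := by
  have h : ∀ A : Finset (Fin n), maxExcess A A = 0 := fun A =>
    le_antisymm (maxExcess_le fun m _ => by simp [excess]) (maxExcess_nonneg _ _)
  simp [tiltedLength, h]

theorem tiltedLength_le_of_path {n : ℕ} {u v : Equiv.Perm (Fin n)} {m : ℕ}
    (h : HasQBGPath u v m) : tiltedLength u v ≤ m := by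
  obtain ⟨p, rfl, rfl, h⟩ := h
  induction m with
  | zero => simp [tiltedLength_self]
  | succ m ih =>
    have h1 := ih fun i hi => h i (by omega)
    have h2 := tiltedLength_le_one_of_edge (h m (by omega))
    have h3 := tiltedLength_triangle (p 0) (p m) (p (m + 1))
    push_cast
    linarith

theorem HasQBGPath.cons {n : ℕ} {u x v : Equiv.Perm (Fin n)} {m : ℕ} (h : QBGEdge u x)
    (hp : HasQBGPath x v m) : HasQBGPath u v (m + 1) := by
  obtain ⟨p, rfl, rfl, hp⟩ := hp
  refine ⟨fun t => Nat.casesOn t u p, rfl, rfl, fun i hi => ?_⟩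
  cases i with
  | zero => exact h
  | succ i => exact hp i (by omega)

/-- `CyclicIoc a b x` says that `x` lies in the cyclic interval `(a, b]` of residues, which is empty
for `a = b`. -/
def CyclicIoc (a b x : ℕ) : Prop :=
  (a < b ∧ a < x ∧ x ≤ b) ∨ (b < a ∧ (a < x ∨ x ≤ b))

/-- If `u` and `v` agree before position `i`, and `u` has no value in the cyclic interval
`(u i, v i]` at the positions from `i + 1` to `k - 1`, then the excess of `v[k]` over `u[k]` is not
maximal at the end points `m` inside that interval, as it grows from `m` to the end of it. -/
theorem excess_lt_maxExcess {n : ℕ} {u v : Equiv.Perm (Fin n)} {i : Fin n}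
    (hagree : ∀ p < i, u p = v p) {k : ℕ} (hik : (i : ℕ) < k)
    (havoid : ∀ p : Fin n, i < p → (p : ℕ) < k → ¬ CyclicIoc (u i) (v i) (u p))
    {m : ℕ} (hm : CyclicIoc (u i) (v i) m) :
    excess (initialSet u k) (initialSet v k) m <
      maxExcess (initialSet u k) (initialSet v k) := by
  refine lt_of_lt_of_le ?_ (excess_le_maxExcess _ _ (m := v i + 1) (v i).isLt)
  have h : excess (initialSet u k) (initialSet v k) (v i + 1) -
      excess (initialSet u k) (initialSet v k) m =
      ∑ p : Fin n, if (p : ℕ) < k then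
        ((if (v p : ℕ) < v i + 1 then (1 : ℤ) else 0) - (if (v p : ℕ) < m then 1 else 0)) -
        ((if (u p : ℕ) < v i + 1 then (1 : ℤ) else 0) - (if (u p : ℕ) < m then 1 else 0))
        else 0 := by
    simp only [excess, countBelow_initialSet, ← sum_sub_distrib]
    refine sum_congr rfl fun p _ => ?_
    by_cases hp : (p : ℕ) < k <;> simp [hp]
    ring
  have hpos : 0 < excess (initialSet u k) (initialSet v k) (v i + 1) -
      excess (initialSet u k) (initialSet v k) m := by
    rw [h]
    refine sum_pos' (fun p _ => ?_) ⟨i, mem_univ _, ?_⟩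
    · by_cases hp : (p : ℕ) < k
      · rw [if_pos hp]
        rcases lt_trichotomy p i with hpi | rfl | hpi
        · rw [hagree p hpi, sub_self]
        · simp only [CyclicIoc] at hm
          split_ifs <;> omega
        · have ha := havoid p hpi hp
          have hne : (u p : ℕ) ≠ u i := fun e => hpi.ne' (u.injective (Fin.ext e))
          simp only [CyclicIoc] at hm ha
          split_ifs <;> omega
      · rw [if_neg hp]
    · rw [if_pos hik]
      simp only [CyclicIoc] at hm
      split_ifs <;> omega
  linarith

/-- At the first position `i` where `u` and `v` differ, exchanging `u i` with the next value of `u`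
lying in the cyclic interval `(u i, v i]` is an edge of the quantum Bruhat graph, and this edge
starts a shortest path from `u` to `v`. -/
theorem exists_edge_tiltedLength_lt {n : ℕ} {u v : Equiv.Perm (Fin n)} {i : Fin n}
    (hagree : ∀ p < i, u p = v p) (hne : u i ≠ v i) :
    ∃ x, QBGEdge u x ∧ tiltedLength x v + 1 ≤ tiltedLength u v ∧ (∀ p < i, x p = v p) ∧
      CyclicIoc (u i) (v i) (x i) := by
  have hne' : (u i : ℕ) ≠ v i := fun e => hne (Fin.ext e)
  obtain ⟨j, hj, hmin⟩ := exists_min_image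
    (univ.filter fun p : Fin n => i < p ∧ ((u i < v i ∧ u i < u p ∧ u p ≤ v i) ∨
      (v i < u i ∧ (u i < u p ∨ u p ≤ v i)))) id ⟨u.symm (v i), by
      simp only [mem_filter, mem_univ, true_and, Equiv.apply_symm_apply]
      refine ⟨?_, by simp only [Fin.lt_def, Fin.le_def]; omega⟩
      rcases lt_trichotomy (u.symm (v i)) i with h | h | h
      · have := hagree _ h
        rw [Equiv.apply_symm_apply] at this
        exact absurd (v.injective this).symm h.ne
      · exact absurd ((Equiv.symm_apply_eq u).1 h).symm hne
      · exact h⟩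
  simp only [mem_filter, mem_univ, true_and, id] at hj hmin
  obtain ⟨hij, hj⟩ := hj
  have hjc : CyclicIoc (u i) (v i) (u j) := hj
  have havoid : ∀ p : Fin n, i < p → p < j → ¬ CyclicIoc (u i) (v i) (u p) :=
    fun p hp hpj hc => absurd (hmin p ⟨hp, hc⟩) (not_le.2 hpj)
  have hij' : (i : ℕ) < j := hij
  have hkey : ∀ k : ℕ, (i : ℕ) < k → k ≤ j → ∀ m, CyclicIoc (u i) (v i) m →
      excess (initialSet u k) (initialSet v k) m <
        maxExcess (initialSet u k) (initialSet v k) := fun k hik hkj m hm =>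
    excess_lt_maxExcess hagree hik (fun p hp hpk => havoid p hp (Fin.lt_def.2 (by omega))) hm
  have hexc : ∀ k m, excess (initialSet (u * Equiv.swap i j) k) (initialSet v k) m =
      excess (initialSet u k) (initialSet v k) m - if (i : ℕ) < k ∧ k ≤ j then
        (if (u j : ℕ) < m then 1 else 0) - (if (u i : ℕ) < m then 1 else 0) else 0 := by
    intro k m
    rw [← excess_initialSet_mul_swap u hij k m,
      ← excess_add (initialSet u k) (initialSet (u * Equiv.swap i j) k)]
    ring
  have hagree' : ∀ p < i, (u * Equiv.swap i j) p = v p := by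
    intro p hp
    rw [← hagree p hp, Equiv.Perm.mul_apply,
      Equiv.swap_apply_of_ne_of_ne hp.ne (hp.trans hij).ne]
  have hx : CyclicIoc (u i) (v i) ((u * Equiv.swap i j) i) := by simpa using hjc
  simp only [CyclicIoc] at hjc havoid hkey
  rcases lt_or_gt_of_ne fun e => hij.ne (u.injective e) with hlt | hlt
  · -- The edge goes up in the Bruhat order.
    have hlt' : (u i : ℕ) < u j := hlt
    have hlen := coxeterLength_mul_swap u hij hlt
    rw [filter_eq_empty_iff.2 (fun p _ ⟨⟨h1, h2⟩, h3, h4⟩ => by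
      have := havoid p h1 h2
      simp only [Fin.lt_def] at h3 h4
      omega), card_empty] at hlen
    refine ⟨u * Equiv.swap i j, ⟨i, j, hij, rfl, Or.inl (by omega)⟩, ?_, hagree', hx⟩
    have : ∑ t : Fin (n - 1), maxExcess (initialSet (u * Equiv.swap i j) (t + 1))
        (initialSet v (t + 1)) ≤
        ∑ t : Fin (n - 1), maxExcess (initialSet u (t + 1)) (initialSet v (t + 1)) :=
      sum_le_sum fun t _ => maxExcess_le fun m hm => by
        have h1 := hkey (t + 1)
        have h2 := excess_le_maxExcess (initialSet u (t + 1)) (initialSet v (t + 1)) hm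
        rw [hexc]
        by_cases ht : (i : ℕ) < t + 1 ∧ (t : ℕ) + 1 ≤ j
        · have h1 := h1 ht.1 ht.2 m
          rw [if_pos ht]
          split_ifs <;> omega
        · rw [if_neg ht]; omega
    simp only [tiltedLength]
    omega
  · -- The edge goes down in the Bruhat order.
    have hlt' : (u j : ℕ) < u i := hlt
    have hlen := coxeterLength_mul_swap (u * Equiv.swap i j) hij (by simpa using hlt)
    rw [mul_assoc, Equiv.swap_mul_self, mul_one] at hlen
    have hcard : (univ.filter fun p => (i < p ∧ p < j) ∧ (u * Equiv.swap i j) i <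
        (u * Equiv.swap i j) p ∧ (u * Equiv.swap i j) p < (u * Equiv.swap i j) j) = Ioo i j := by
      ext p
      simp only [mem_filter, mem_univ, true_and, mem_Ioo, and_iff_left_iff_imp]
      rintro ⟨h1, h2⟩
      have := havoid p h1 h2
      have e1 : (u p : ℕ) ≠ u i := fun e => h1.ne' (u.injective (Fin.ext e))
      have e2 : (u p : ℕ) ≠ u j := fun e => h2.ne (u.injective (Fin.ext e))
      simp only [Equiv.Perm.mul_apply, Equiv.swap_apply_left, Equiv.swap_apply_right,
        Equiv.swap_apply_of_ne_of_ne h1.ne' h2.ne, Fin.lt_def]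
      omega
    rw [hcard, Fin.card_Ioo] at hlen
    refine ⟨u * Equiv.swap i j, ⟨i, j, hij, rfl, Or.inr (by omega)⟩, ?_, hagree', hx⟩
    have : ∑ t : Fin (n - 1), maxExcess (initialSet (u * Equiv.swap i j) (t + 1))
        (initialSet v (t + 1)) ≤
        ∑ t : Fin (n - 1), (maxExcess (initialSet u (t + 1)) (initialSet v (t + 1)) -
          (if (i : ℕ) < t + 1 ∧ (t : ℕ) + 1 ≤ j then (1 : ℤ) else 0)) :=
      sum_le_sum fun t _ => maxExcess_le fun m hm => by
        have h1 := hkey (t + 1)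
        have h2 := excess_le_maxExcess (initialSet u (t + 1)) (initialSet v (t + 1)) hm
        rw [hexc]
        by_cases ht : (i : ℕ) < t + 1 ∧ (t : ℕ) + 1 ≤ j
        · have h1 := h1 ht.1 ht.2 m
          rw [if_pos ht, if_pos ht]
          split_ifs <;> omega
        · rw [if_neg ht, if_neg ht]; omega
    rw [sum_sub_distrib, sum_indicator_between hij] at this
    simp only [tiltedLength]
    omega

theorem exists_path_le_tiltedLength {n : ℕ} (u v : Equiv.Perm (Fin n)) :
    ∃ m, HasQBGPath u v m ∧ (m : ℤ) ≤ tiltedLength u v := by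
  suffices H : ∀ i ≤ n, ∀ u : Equiv.Perm (Fin n), (∀ p : Fin n, (p : ℕ) < i → u p = v p) →
      ∃ m, HasQBGPath u v m ∧ (m : ℤ) ≤ tiltedLength u v from
    H 0 n.zero_le u fun p hp => absurd hp (Nat.not_lt_zero _)
  intro i hi
  induction hi using Nat.decreasingInduction with
  | self =>
    intro u hu
    obtain rfl : u = v := Equiv.ext fun p => hu p p.isLt
    exact ⟨0, ⟨fun _ => u, rfl, rfl, fun i hi => absurd hi (Nat.not_lt_zero _)⟩,
      by simp [tiltedLength_self]⟩
  | of_succ i hi ih =>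
    -- Inner induction on the cyclic distance from `u i` to `v i`.
    suffices H : ∀ (s : ℕ) (u : Equiv.Perm (Fin n)), (∀ p : Fin n, (p : ℕ) < i → u p = v p) →
        (if (u ⟨i, hi⟩ : ℕ) ≤ v ⟨i, hi⟩ then (v ⟨i, hi⟩ : ℕ) - u ⟨i, hi⟩
          else n + v ⟨i, hi⟩ - u ⟨i, hi⟩) = s →
        ∃ m, HasQBGPath u v m ∧ (m : ℤ) ≤ tiltedLength u v from fun u hu => H _ u hu rfl
    intro s
    induction s using Nat.strong_induction_on with
    | _ s ihs =>
      intro u hu hs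
      by_cases hne : u ⟨i, hi⟩ = v ⟨i, hi⟩
      · refine ih u fun p hp => ?_
        rcases Nat.lt_succ_iff_lt_or_eq.1 hp with h | h
        · exact hu p h
        · obtain rfl : p = ⟨i, hi⟩ := Fin.ext h
          exact hne
      · obtain ⟨x, hedge, hlen, hx, hc⟩ :=
          exists_edge_tiltedLength_lt (i := ⟨i, hi⟩) (fun p hp => hu p hp) hne
        obtain ⟨m, hm, hle⟩ := ihs _ (by
          have := (x ⟨i, hi⟩).isLt
          have := (u ⟨i, hi⟩).isLt
          simp only [CyclicIoc] at hc
          rw [← hs]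
          split_ifs <;> omega) x (fun p hp => hx p hp) rfl
        exact ⟨m + 1, hm.cons hedge, by push_cast; omega⟩

theorem qbgDist_eq {n : ℕ} (u v : Equiv.Perm (Fin n)) : (qbgDist u v : ℤ) = tiltedLength u v := by
  obtain ⟨m, hm, hle⟩ := exists_path_le_tiltedLength u v
  refine le_antisymm ((Nat.cast_le.2 (Nat.sInf_le hm)).trans hle) ?_
  exact tiltedLength_le_of_path (Nat.sInf_mem ⟨m, hm⟩ : qbgDist u v ∈ {m | HasQBGPath u v m})

theorem mem_tiltedInterval_iff {n : ℕ} {u v w : Equiv.Perm (Fin n)} :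
    w ∈ tiltedInterval u v ↔ ∀ t : Fin (n - 1),
      maxExcess (initialSet u (t + 1)) (initialSet w (t + 1)) +
        maxExcess (initialSet w (t + 1)) (initialSet v (t + 1)) =
      maxExcess (initialSet u (t + 1)) (initialSet v (t + 1)) := by
  have h0 : qbgDist u u = 0 := by
    have := qbgDist_eq u u
    rw [tiltedLength_self] at this
    exact_mod_cast this
  have h1 := sum_eq_sum_iff_of_le fun (t : Fin (n - 1)) (_ : t ∈ univ) =>
    maxExcess_triangle (initialSet u (t + 1)) (initialSet w (t + 1)) (initialSet v (t + 1))
  simp only [mem_univ, true_imp_iff] at h1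
  have h2 : w ∈ tiltedInterval u v ↔
      tiltedLength u w + tiltedLength w v = tiltedLength u v := by
    rw [← qbgDist_eq, ← qbgDist_eq, ← qbgDist_eq]
    simp only [tiltedInterval, TiltedLE, Set.mem_ofPred_eq, h0, zero_add, true_and]
    exact_mod_cast Iff.rfl
  rw [h2]
  simp only [eq_comm (b := maxExcess (initialSet u _) (initialSet v _)), ← h1]
  simp only [tiltedLength, sum_add_distrib]
  constructor <;> intro h <;> linarith

/-! ### Shifted Gale orders and tilted intervals -/

theorem galeLE_iff {n : ℕ} (A B : Finset (Fin n)) :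
    GaleLE A B ↔ A.card = B.card ∧ ∀ m, countBelow B m ≤ countBelow A m := by
  have key : ∀ (C : Finset (Fin n)) (k : ℕ) (h : C.card = k) (m : ℕ),
      countBelow C m = (univ.filter fun i : Fin k => (C.orderEmbOfFin h i : ℕ) < m).card := by
    intro C k h m
    rw [countBelow, ← card_map (C.orderEmbOfFin h).toEmbedding, map_filter' ]
    congr 1
    ext x
    simp only [mem_filter, mem_map, mem_univ, true_and, RelEmbedding.coe_toEmbedding]
    constructor
    · rintro ⟨hx, hm⟩
      have : x ∈ Set.range (C.orderEmbOfFin h) := by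
        rw [range_orderEmbOfFin]; exact hx
      obtain ⟨i, rfl⟩ := this
      exact ⟨⟨i, rfl⟩, i, hm, rfl⟩
    · rintro ⟨-, i, hm, rfl⟩
      exact ⟨orderEmbOfFin_mem _ _ _, hm⟩
  constructor
  · rintro ⟨h, H⟩
    refine ⟨h, fun m => ?_⟩
    rw [key A _ h, key B _ rfl]
    exact card_le_card fun i hi => by
      simp only [mem_filter, mem_univ, true_and] at hi ⊢
      exact lt_of_le_of_lt (H i) hi
  · rintro ⟨h, H⟩
    refine ⟨h, fun i => ?_⟩
    by_contra hlt
    rw [not_le] at hlt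
    have := H (A.orderEmbOfFin h i)
    rw [key A _ h, key B _ rfl] at this
    have h1 : (univ.filter fun t => (A.orderEmbOfFin h t : ℕ) < A.orderEmbOfFin h i) = Iio i := by
      ext t
      simp
    have h2 : Iic i ⊆
        univ.filter fun t => (B.orderEmbOfFin rfl t : ℕ) < A.orderEmbOfFin h i := fun t ht => by
      simp only [mem_filter, mem_univ, true_and]
      exact lt_of_le_of_lt ((B.orderEmbOfFin rfl).monotone (mem_Iic.1 ht)) hlt
    have h3 := card_le_card h2
    rw [h1, Fin.card_Iio] at this
    rw [Fin.card_Iic] at h3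
    omega

/-- The position of `x` in the shifted order `r <_r r + 1 <_r ⋯ <_r r - 1`, counted from `0`. -/
def shiftedRank {n : ℕ} (r x : Fin n) : ℕ := (x - r : Fin n)

theorem shiftedRank_eq {n : ℕ} (r x : Fin n) :
    shiftedRank r x = if (r : ℕ) ≤ x then (x : ℕ) - r else n + x - r := by
  rw [shiftedRank]
  split_ifs with h
  · exact Fin.coe_sub_iff_le.2 h
  · exact Fin.coe_sub_iff_lt.2 (not_le.1 h)

theorem shiftedRank_lt {n : ℕ} (r x : Fin n) : shiftedRank r x < n := (x - r).isLt

theorem shiftedRank_injective {n : ℕ} (r : Fin n) : Function.Injective (shiftedRank r) := by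
  intro x y h
  rw [shiftedRank_eq, shiftedRank_eq] at h
  apply Fin.ext
  split_ifs at h <;> omega

theorem shiftedGaleLE_iff {n : ℕ} (r : Fin n) (A B : Finset (Fin n)) :
    ShiftedGaleLE r A B ↔ A.card = B.card ∧
      ∀ m, (B.filter fun x => shiftedRank r x < m).card ≤
        (A.filter fun x => shiftedRank r x < m).card := by
  have hinj : Function.Injective fun x : Fin n => x - r := fun x y h =>
    shiftedRank_injective r (congrArg Fin.val h)
  rw [ShiftedGaleLE, galeLE_iff]
  simp only [countBelow, filter_image, card_image_of_injective _ hinj]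
  rfl

theorem card_filter_shiftedRank_of_le {n : ℕ} (r : Fin n) (A : Finset (Fin n)) {m : ℕ}
    (hm : r + m ≤ n) :
    (A.filter fun x => shiftedRank r x < m).card + countBelow A r = countBelow A (r + m) := by
  simp only [countBelow, card_filter, ← sum_add_distrib]
  refine sum_congr rfl fun x _ => ?_
  rw [shiftedRank_eq]
  split_ifs <;> omega

theorem card_filter_shiftedRank_of_ge {n : ℕ} (r : Fin n) (A : Finset (Fin n)) {m : ℕ}
    (hm : n ≤ r + m) (hm' : m ≤ n) :
    (A.filter fun x => shiftedRank r x < m).card + countBelow A r =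
      A.card + countBelow A (r + m - n) := by
  rw [card_eq_sum_ones A]
  simp only [countBelow, card_filter, ← sum_add_distrib]
  refine sum_congr rfl fun x _ => ?_
  rw [shiftedRank_eq]
  split_ifs <;> omega

/-- `A ≤_r B` holds exactly when the excess of `B` over `A` is maximal just before `r`. -/
theorem shiftedGaleLE_iff_maxExcess {n : ℕ} (r : Fin n) {A B : Finset (Fin n)}
    (h : A.card = B.card) : ShiftedGaleLE r A B ↔ maxExcess A B = excess A B r := by
  have hr := r.isLt
  rw [shiftedGaleLE_iff]
  constructor
  · rintro ⟨-, H⟩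
    refine le_antisymm (maxExcess_le fun m hm => ?_) (excess_le_maxExcess A B hr.le)
    simp only [excess]
    rcases le_total (r : ℕ) m with hrm | hrm
    · have h1 := card_filter_shiftedRank_of_le r A (m := m - r) (by omega)
      have h2 := card_filter_shiftedRank_of_le r B (m := m - r) (by omega)
      have h3 := H (m - r)
      rw [Nat.add_sub_cancel' hrm] at h1 h2
      omega
    · have h1 := card_filter_shiftedRank_of_ge r A (m := m + n - r) (by omega) (by omega)
      have h2 := card_filter_shiftedRank_of_ge r B (m := m + n - r) (by omega) (by omega)
      have h3 := H (m + n - r)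
      rw [show (r : ℕ) + (m + n - r) - n = m by omega] at h1 h2
      omega
  · intro H
    refine ⟨h, fun m => ?_⟩
    rcases le_total n m with hm | hm
    · rw [filter_true_of_mem fun x _ => (shiftedRank_lt r x).trans_le hm,
        filter_true_of_mem fun x _ => (shiftedRank_lt r x).trans_le hm, h]
    rcases le_total (r + m) n with hrm | hrm
    · have h1 := card_filter_shiftedRank_of_le r A hrm
      have h2 := card_filter_shiftedRank_of_le r B hrm
      have h3 := excess_le_maxExcess A B hrm
      simp only [excess] at h3 H
      omega
    · have h1 := card_filter_shiftedRank_of_ge r A hrm hm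
      have h2 := card_filter_shiftedRank_of_ge r B hrm hm
      have h3 := excess_le_maxExcess A B (m := r + m - n) (by omega)
      simp only [excess] at h3 H
      omega

theorem exists_shiftedGaleLE {n : ℕ} (hn : 0 < n) {A B : Finset (Fin n)} (h : A.card = B.card) :
    ∃ r, ShiftedGaleLE r A B := by
  obtain ⟨m, hm, hmax⟩ := exists_maxExcess_eq A B
  rcases hm.lt_or_eq with hlt | rfl
  · exact ⟨⟨m, hlt⟩, (shiftedGaleLE_iff_maxExcess _ h).2 hmax⟩
  · -- The excess vanishes both at `0` and at `n`.
    refine ⟨⟨0, hn⟩, (shiftedGaleLE_iff_maxExcess _ h).2 ?_⟩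
    rw [hmax, excess_self h, excess_zero]

theorem shiftedGaleLE_between_iff {n : ℕ} {r : Fin n} {A B C : Finset (Fin n)}
    (hAC : A.card = C.card) (hCB : C.card = B.card) (h : ShiftedGaleLE r A B) :
    maxExcess A C + maxExcess C B = maxExcess A B ↔
      ShiftedGaleLE r A C ∧ ShiftedGaleLE r C B := by
  rw [shiftedGaleLE_iff_maxExcess r (hAC.trans hCB)] at h
  rw [shiftedGaleLE_iff_maxExcess r hAC, shiftedGaleLE_iff_maxExcess r hCB, h,
    ← excess_add A C B]
  have h1 := excess_le_maxExcess A C r.isLt.le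
  have h2 := excess_le_maxExcess C B r.isLt.le
  constructor
  · intro h; constructor <;> linarith
  · rintro ⟨h1, h2⟩; rw [h1, h2]

theorem card_initialSet_succ {n : ℕ} (w : Equiv.Perm (Fin n)) (i : Fin (n - 1)) :
    (initialSet w (i + 1)).card = i + 1 :=
  card_initialSet w (by omega)

theorem exists_seqLE {n : ℕ} (u v : Equiv.Perm (Fin n)) : ∃ a, SeqLE a u v := by
  have H : ∀ i : Fin (n - 1), ∃ r,
      ShiftedGaleLE r (initialSet u (i + 1)) (initialSet v (i + 1)) := fun i =>
    exists_shiftedGaleLE (have := i.isLt; by omega) (by rw [card_initialSet_succ, card_initialSet_succ])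
  choose a ha using H
  exact ⟨a, ha⟩

theorem mem_tiltedInterval_iff_seqLE {n : ℕ} {u v w : Equiv.Perm (Fin n)}
    {a : Fin (n - 1) → Fin n} (h : SeqLE a u v) :
    w ∈ tiltedInterval u v ↔ SeqLE a u w ∧ SeqLE a w v := by
  rw [mem_tiltedInterval_iff, SeqLE, SeqLE, ← forall_and]
  exact forall_congr' fun i => shiftedGaleLE_between_iff
    (by rw [card_initialSet_succ, card_initialSet_succ])
    (by rw [card_initialSet_succ, card_initialSet_succ]) (h i)

/-! ### Coordinate bases of a subspace -/

/-- The coordinates in `I` are linearly independent functionals on `V`: they take arbitrary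
values on `V`. -/
def IndepCoords {n : ℕ} (V : Submodule ℂ (Fin n → ℂ)) (I : Finset (Fin n)) : Prop :=
  ∀ y : Fin n → ℂ, ∃ x ∈ V, ∀ i ∈ I, x i = y i

/-- The coordinates in `I` form a basis of the dual space of `V`, that is, `I` is a basis of the
matroid of `V`: the projection of `V` to `ℂ^I` is bijective. -/
def IsCoordBasis {n : ℕ} (V : Submodule ℂ (Fin n → ℂ)) (I : Finset (Fin n)) : Prop :=
  IndepCoords V I ∧ ∀ x ∈ V, (∀ i ∈ I, x i = 0) → x = 0

theorem IndepCoords.mono {n : ℕ} {V W : Submodule ℂ (Fin n → ℂ)} {I J : Finset (Fin n)}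
    (h : IndepCoords V I) (hVW : V ≤ W) (hJI : J ⊆ I) : IndepCoords W J := fun y =>
  let ⟨x, hx, hy⟩ := h y
  ⟨x, hVW hx, fun i hi => hy i (hJI hi)⟩

/-- An independent set of coordinates in `S` extends to one that spans all coordinates in `S`. -/
theorem IndepCoords.exists_extend {n : ℕ} {V : Submodule ℂ (Fin n → ℂ)} {I₀ S : Finset (Fin n)}
    (h : IndepCoords V I₀) (hS : I₀ ⊆ S) :
    ∃ I, I₀ ⊆ I ∧ I ⊆ S ∧ IndepCoords V I ∧
      ∀ x ∈ V, (∀ i ∈ I, x i = 0) → ∀ i ∈ S, x i = 0 := by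
  classical
  obtain ⟨I, hI, hmax⟩ := exists_max_image
    (S.powerset.filter fun I => I₀ ⊆ I ∧ IndepCoords V I) card
    ⟨I₀, mem_filter.2 ⟨mem_powerset.2 hS, Subset.rfl, h⟩⟩
  simp only [mem_filter, mem_powerset] at hI hmax
  obtain ⟨hIS, hI₀, hind⟩ := hI
  refine ⟨I, hI₀, hIS, hind, fun x hx hxI j hj => ?_⟩
  by_contra hxj
  have hjI : j ∉ I := fun hjI => hxj (hxI j hjI)
  have := hmax (insert j I) ⟨insert_subset hj hIS, hI₀.trans (subset_insert _ _), fun y => by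
    obtain ⟨z, hz, hzy⟩ := hind y
    refine ⟨z + ((y j - z j) / x j) • x, V.add_mem hz (V.smul_mem _ hx), fun i hi => ?_⟩
    rcases mem_insert.1 hi with rfl | hi
    · simp [div_mul_cancel₀ _ hxj]
    · simp [hxI i hi, hzy i hi]⟩
  rw [card_insert_of_notMem hjI] at this
  omega

theorem IndepCoords.exists_isCoordBasis {n : ℕ} {V : Submodule ℂ (Fin n → ℂ)}
    {I₀ : Finset (Fin n)} (h : IndepCoords V I₀) : ∃ I, I₀ ⊆ I ∧ IsCoordBasis V I := by
  obtain ⟨I, h₀, -, hI, hx⟩ := h.exists_extend (subset_univ _)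
  exact ⟨I, h₀, hI, fun x hxV h0 => funext fun i => hx x hxV h0 i (mem_univ i)⟩

theorem indepCoords_empty {n : ℕ} (V : Submodule ℂ (Fin n → ℂ)) : IndepCoords V ∅ :=
  fun _ => ⟨0, V.zero_mem, by simp⟩

theorem IsCoordBasis.exists_subset {n : ℕ} {V W : Submodule ℂ (Fin n → ℂ)} {I : Finset (Fin n)}
    (h : IsCoordBasis W I) (hVW : V ≤ W) : ∃ J, J ⊆ I ∧ IsCoordBasis V J := by
  obtain ⟨J, -, hJI, hJ, hx⟩ := (indepCoords_empty V).exists_extend (empty_subset I)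
  exact ⟨J, hJI, hJ, fun x hxV h0 => h.2 x (hVW hxV) (hx x hxV h0)⟩

/-! ### Dimensions of coordinate projections -/

/-- The vectors of `V` whose coordinates in `S` vanish. -/
def coordKer {n : ℕ} (S : Finset (Fin n)) (V : Submodule ℂ (Fin n → ℂ)) : Submodule ℂ V :=
  LinearMap.ker ((LinearMap.funLeft ℂ ℂ (fun x : S => (x : Fin n))).domRestrict V)

theorem mem_coordKer {n : ℕ} {S : Finset (Fin n)} {V : Submodule ℂ (Fin n → ℂ)} {x : V} :
    x ∈ coordKer S V ↔ ∀ i ∈ S, (x : Fin n → ℂ) i = 0 := by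
  simp [coordKer, funext_iff, LinearMap.funLeft]

theorem projDim_add_finrank_coordKer {n : ℕ} (S : Finset (Fin n))
    (V : Submodule ℂ (Fin n → ℂ)) :
    projDim S V + Module.finrank ℂ (coordKer S V) = Module.finrank ℂ V := by
  rw [projDim, coordKer, ← LinearMap.range_domRestrict]
  exact LinearMap.finrank_range_add_finrank_ker _

theorem projDim_le_of_forall {n : ℕ} {S T : Finset (Fin n)} {V : Submodule ℂ (Fin n → ℂ)}
    (h : ∀ x ∈ V, (∀ i ∈ T, x i = 0) → ∀ i ∈ S, x i = 0) : projDim S V ≤ projDim T V := by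
  have h1 := projDim_add_finrank_coordKer S V
  have h2 := projDim_add_finrank_coordKer T V
  have h3 : Module.finrank ℂ (coordKer T V) ≤ Module.finrank ℂ (coordKer S V) :=
    Submodule.finrank_mono fun x hx => mem_coordKer.2 (h x x.2 (mem_coordKer.1 hx))
  omega

theorem projDim_mono {n : ℕ} {S T : Finset (Fin n)} (h : S ⊆ T) (V : Submodule ℂ (Fin n → ℂ)) :
    projDim S V ≤ projDim T V :=
  projDim_le_of_forall fun _ _ hT i hi => hT i (h hi)

theorem projDim_lt_of_ne_zero {n : ℕ} {S T : Finset (Fin n)} {V : Submodule ℂ (Fin n → ℂ)}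
    (hST : S ⊆ T) {x : Fin n → ℂ} (hx : x ∈ V) (hS : ∀ i ∈ S, x i = 0) {j : Fin n} (hj : j ∈ T)
    (hxj : x j ≠ 0) : projDim S V < projDim T V := by
  have h1 := projDim_add_finrank_coordKer S V
  have h2 := projDim_add_finrank_coordKer T V
  have h3 : Module.finrank ℂ (coordKer T V) < Module.finrank ℂ (coordKer S V) := by
    refine Submodule.finrank_lt_finrank_of_lt (lt_of_le_of_ne
      (fun y hy => mem_coordKer.2 fun i hi => mem_coordKer.1 hy i (hST hi)) fun e => hxj ?_)
    have : (⟨x, hx⟩ : V) ∈ coordKer T V := e ▸ mem_coordKer.2 hS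
    exact mem_coordKer.1 this j hj
  omega

theorem projDim_eq_card_iff {n : ℕ} {I : Finset (Fin n)} {V : Submodule ℂ (Fin n → ℂ)} :
    projDim I V = I.card ↔ IndepCoords V I := by
  have hcard : Module.finrank ℂ (I → ℂ) = I.card := by simp
  constructor
  · intro h y
    have htop := Submodule.eq_top_of_finrank_eq (h.trans hcard.symm)
    have : (fun i : I => y i) ∈ V.map (LinearMap.funLeft ℂ ℂ (fun x : I => (x : Fin n))) := by
      rw [htop]; trivial
    obtain ⟨x, hx, hxy⟩ := this
    exact ⟨x, hx, fun i hi => congrFun hxy ⟨i, hi⟩⟩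
  · intro h
    suffices htop : V.map (LinearMap.funLeft ℂ ℂ (fun x : I => (x : Fin n))) = ⊤ by
      rw [projDim, htop, finrank_top, hcard]
    refine Submodule.eq_top_iff'.2 fun y => ?_
    obtain ⟨x, hx, hxy⟩ := h fun i => if hi : i ∈ I then y ⟨i, hi⟩ else 0
    refine ⟨x, hx, funext fun i => ?_⟩
    have := hxy i i.2
    rw [dif_pos i.2] at this
    exact this

theorem projDim_eq_finrank_of_injective {n : ℕ} {I : Finset (Fin n)}
    {V : Submodule ℂ (Fin n → ℂ)} (h : ∀ x ∈ V, (∀ i ∈ I, x i = 0) → x = 0) :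
    projDim I V = Module.finrank ℂ V := by
  have h0 : coordKer I V = ⊥ := (Submodule.eq_bot_iff _).2 fun x hx =>
    Subtype.ext (h x x.2 (mem_coordKer.1 hx))
  have := projDim_add_finrank_coordKer I V
  rwa [h0, finrank_bot, add_zero] at this

theorem IsCoordBasis.card_eq {n : ℕ} {I : Finset (Fin n)} {V : Submodule ℂ (Fin n → ℂ)}
    (h : IsCoordBasis V I) : I.card = Module.finrank ℂ V :=
  (projDim_eq_card_iff.2 h.1).symm.trans (projDim_eq_finrank_of_injective h.2)

theorem isCoordBasis_of_card_eq {n : ℕ} {I : Finset (Fin n)} {V : Submodule ℂ (Fin n → ℂ)}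
    (hI : I.card = Module.finrank ℂ V) (h : ∀ x ∈ V, (∀ i ∈ I, x i = 0) → x = 0) :
    IsCoordBasis V I :=
  ⟨projDim_eq_card_iff.1 ((projDim_eq_finrank_of_injective h).trans hI.symm), h⟩

theorem IsCoordBasis.card_inter_le_projDim {n : ℕ} {I : Finset (Fin n)}
    {V : Submodule ℂ (Fin n → ℂ)} (h : IsCoordBasis V I) (S : Finset (Fin n)) :
    (I ∩ S).card ≤ projDim S V := by
  rw [← projDim_eq_card_iff.2 (h.1.mono le_rfl (inter_subset_left (s₂ := S)))]
  exact projDim_mono inter_subset_right V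

/-- The dimension of a coordinate projection is the rank in the matroid of `V`, that is, the maximal
size of the intersection with a basis. -/
theorem projDim_le_iff {n : ℕ} {S : Finset (Fin n)} {V : Submodule ℂ (Fin n → ℂ)} {c : ℕ} :
    projDim S V ≤ c ↔ ∀ I, IsCoordBasis V I → (I ∩ S).card ≤ c := by
  refine ⟨fun h I hI => (hI.card_inter_le_projDim S).trans h, fun h => ?_⟩
  obtain ⟨J, -, hJS, hJ, hx⟩ := (indepCoords_empty V).exists_extend (empty_subset S)
  obtain ⟨I, hJI, hI⟩ := hJ.exists_isCoordBasis
  calc projDim S V ≤ projDim J V := projDim_le_of_forall hx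
    _ = J.card := projDim_eq_card_iff.2 hJ
    _ ≤ (I ∩ S).card := card_le_card (subset_inter hJI hJS)
    _ ≤ c := h I hI

/-- If the dimension of the projection of `V` to each initial interval of a linear order is the
number of elements of `A` in it, then `A` is a basis: it is the set of positions of the first
nonzero coordinates of the vectors of `V`. The order is given by the injective function `ψ`. -/
theorem isCoordBasis_of_projDim_eq {n : ℕ} {ψ : Fin n → ℕ} (hψ : Function.Injective ψ)
    {A : Finset (Fin n)} {V : Submodule ℂ (Fin n → ℂ)} (hA : A.card = Module.finrank ℂ V)
    (h : ∀ m, projDim (univ.filter fun x => ψ x < m) V =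
      (A ∩ univ.filter fun x => ψ x < m).card) : IsCoordBasis V A := by
  refine isCoordBasis_of_card_eq hA fun x hx hxA => ?_
  by_contra hne
  obtain ⟨i, hi, hmin⟩ := exists_min_image (univ.filter fun i => x i ≠ 0) ψ
    ((Function.ne_iff.1 hne).imp fun i hi => by simpa using hi)
  simp only [mem_filter, mem_univ, true_and] at hi hmin
  have hlt := projDim_lt_of_ne_zero (V := V) (S := univ.filter fun x => ψ x < ψ i)
    (T := univ.filter fun x => ψ x < ψ i + 1)
    (fun p hp => by simp only [mem_filter, mem_univ, true_and] at hp ⊢; omega) hx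
    (fun p hp => by
      by_contra hxp
      simp only [mem_filter, mem_univ, true_and] at hp
      exact absurd (hmin p hxp) (not_le.2 hp)) (j := i) (by simp) hi
  rw [h, h] at hlt
  refine absurd (card_le_card fun p hp => ?_) (not_le.2 hlt)
  simp only [mem_inter, mem_filter, mem_univ, true_and] at hp ⊢
  refine ⟨hp.1, lt_of_le_of_ne (Nat.lt_succ_iff.1 hp.2) fun e => hi ?_⟩
  rw [← hψ e]
  exact hxA p hp.1

/-! ### Plücker coordinates and bases of flags -/

theorem pluckerOfBasis_ne_zero_iff {n k : ℕ} {V : Submodule ℂ (Fin n → ℂ)}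
    (b : Module.Basis (Fin k) ℂ V) (I : Finset (Fin n)) (hI : I.card = k) :
    pluckerOfBasis b I hI ≠ 0 ↔ IsCoordBasis V I := by
  have hrank : I.card = Module.finrank ℂ V := by
    rw [Module.finrank_eq_card_basis b, Fintype.card_fin, hI]
  have hmul : ∀ c : Fin k → ℂ,
      (Matrix.of fun r c : Fin k => (b c : Fin n → ℂ) (I.orderEmbOfFin hI r)).mulVec c = 0 ↔
      ∀ i ∈ I, (b.equivFun.symm c : Fin n → ℂ) i = 0 := by
    intro c
    have : ∀ r, (Matrix.of fun r c : Fin k =>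
        (b c : Fin n → ℂ) (I.orderEmbOfFin hI r)).mulVec c r =
        (b.equivFun.symm c : Fin n → ℂ) (I.orderEmbOfFin hI r) := by
      intro r
      simp [Matrix.mulVec, dotProduct, Module.Basis.equivFun_symm_apply, mul_comm]
    constructor
    · intro h i hi
      have hi' : i ∈ Set.range (I.orderEmbOfFin hI) := by rw [range_orderEmbOfFin]; exact hi
      obtain ⟨r, rfl⟩ := hi'
      rw [← this, h, Pi.zero_apply]
    · intro h
      ext r
      rw [this, Pi.zero_apply, h _ (orderEmbOfFin_mem _ _ _)]
  rw [pluckerOfBasis, ne_eq, ← Matrix.exists_mulVec_eq_zero_iff]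
  constructor
  · intro h
    refine isCoordBasis_of_card_eq hrank fun x hx h0 => ?_
    by_contra hne
    refine h ⟨b.equivFun ⟨x, hx⟩, fun e => hne ?_, (hmul _).2 ?_⟩
    · have := (LinearEquiv.map_eq_zero_iff _).1 e
      exact congrArg Subtype.val this
    · rw [LinearEquiv.symm_apply_apply]
      exact h0
  · rintro h ⟨c, hc, h0⟩
    have := h.2 _ (b.equivFun.symm c).2 ((hmul c).1 h0)
    exact hc ((LinearEquiv.map_eq_zero_iff _).1 (Subtype.ext this))

/-- The subspace `F_k` of a flag, extended by `F_k = ℂⁿ` to all `k > n`. -/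
def CompleteFlag.spaceNat {n : ℕ} (F : CompleteFlag n) (k : ℕ) : Submodule ℂ (Fin n → ℂ) :=
  F.space ⟨min k n, by omega⟩

theorem CompleteFlag.spaceNat_mono {n : ℕ} (F : CompleteFlag n) : Monotone F.spaceNat :=
  fun _ _ h => F.mono (Fin.mk_le_mk.2 (min_le_min_right n h))

theorem CompleteFlag.finrank_spaceNat {n : ℕ} (F : CompleteFlag n) {k : ℕ} (hk : k ≤ n) :
    Module.finrank ℂ (F.spaceNat k) = k := by
  rw [CompleteFlag.spaceNat, F.finrank_space]
  exact min_eq_left hk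

theorem CompleteFlag.space_eq_spaceNat {n : ℕ} (F : CompleteFlag n) (k : ℕ) (hk : k < n + 1) :
    F.space ⟨k, hk⟩ = F.spaceNat k := by
  rw [CompleteFlag.spaceNat]
  congr
  omega

theorem CompleteFlag.step_eq_spaceNat {n : ℕ} (F : CompleteFlag n) (i : Fin (n - 1)) :
    F.step i = F.spaceNat (i + 1) :=
  F.space_eq_spaceNat _ _

theorem CompleteFlag.finrank_step {n : ℕ} (F : CompleteFlag n) (i : Fin (n - 1)) :
    Module.finrank ℂ (F.step i) = i + 1 :=
  F.finrank_space _

theorem CompleteFlag.plucker_ne_zero_iff {n : ℕ} (F : CompleteFlag n) (I : Finset (Fin n)) :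
    F.plucker I ≠ 0 ↔ IsCoordBasis (F.spaceNat I.card) I := by
  rw [CompleteFlag.plucker, pluckerOfBasis_ne_zero_iff, F.space_eq_spaceNat]

theorem CompleteFlag.pluckerPerm_ne_zero_iff {n : ℕ} (F : CompleteFlag n)
    (w : Equiv.Perm (Fin n)) :
    F.pluckerPerm w ≠ 0 ↔ ∀ i : Fin (n - 1), IsCoordBasis (F.step i) (initialSet w (i + 1)) := by
  rw [CompleteFlag.pluckerPerm, prod_ne_zero_iff]
  simp only [mem_univ, true_imp_iff, F.plucker_ne_zero_iff, card_initialSet_succ,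
    F.step_eq_spaceNat]

theorem exists_perm_initialSet_eq {n : ℕ} {B : ℕ → Finset (Fin n)} (hB : Monotone B)
    (hcard : ∀ j ≤ n, (B j).card = j) :
    ∃ w : Equiv.Perm (Fin n), ∀ j ≤ n, initialSet w j = B j := by
  have H : ∀ p : Fin n, ∃ x, x ∈ B (p + 1) \ B p := fun p => by
    have h1 := hcard (p + 1) p.isLt
    have h2 := hcard p p.isLt.le
    have h3 := le_card_sdiff (B p) (B (p + 1))
    exact card_pos.1 (by omega)
  choose f hf using H
  simp only [mem_sdiff] at hf
  have hlt : ∀ p q, p < q → f p ≠ f q := fun p q hpq e =>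
    (hf q).2 (e ▸ hB (Nat.succ_le_of_lt (Fin.lt_def.1 hpq)) (hf p).1)
  have hinj : Function.Injective f := fun p q e => by
    rcases lt_trichotomy p q with h | h | h
    · exact absurd e (hlt p q h)
    · exact h
    · exact absurd e.symm (hlt q p h)
  refine ⟨Equiv.ofBijective f (Finite.injective_iff_bijective.1 hinj), fun j hj => ?_⟩
  refine eq_of_subset_of_card_le (fun x hx => ?_) (by rw [hcard j hj, card_initialSet _ hj])
  simp only [initialSet, mem_image, mem_filter, mem_univ, true_and,
    Equiv.ofBijective_apply] at hx
  obtain ⟨p, hp, rfl⟩ := hx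
  exact hB (Nat.succ_le_of_lt hp) (hf p).1

/-- Each basis of `F_k` is part of a chain of bases of the subspaces of the flag, and such a chain
is the chain of initial sets of a permutation. -/
theorem CompleteFlag.exists_perm_of_isCoordBasis {n : ℕ} (F : CompleteFlag n) {k : ℕ}
    (hk : k ≤ n) {I : Finset (Fin n)} (hI : IsCoordBasis (F.spaceNat k) I) :
    ∃ w : Equiv.Perm (Fin n), initialSet w k = I ∧
      ∀ j ≤ n, IsCoordBasis (F.spaceNat j) (initialSet w j) := by
  have Hup : ∀ (j : ℕ) (J : Finset (Fin n)), ∃ J', IsCoordBasis (F.spaceNat j) J →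
      J ⊆ J' ∧ IsCoordBasis (F.spaceNat (j + 1)) J' := fun j J => by
    by_cases hJ : IsCoordBasis (F.spaceNat j) J
    · obtain ⟨J', h⟩ :=
        (hJ.1.mono (F.spaceNat_mono j.le_succ) Subset.rfl).exists_isCoordBasis
      exact ⟨J', fun _ => h⟩
    · exact ⟨∅, fun h => absurd h hJ⟩
  have Hdn : ∀ (j : ℕ) (J : Finset (Fin n)), ∃ J', IsCoordBasis (F.spaceNat j) J →
      J' ⊆ J ∧ IsCoordBasis (F.spaceNat (j - 1)) J' := fun j J => by
    by_cases hJ : IsCoordBasis (F.spaceNat j) J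
    · obtain ⟨J', h⟩ := hJ.exists_subset (F.spaceNat_mono (Nat.sub_le j 1))
      exact ⟨J', fun _ => h⟩
    · exact ⟨∅, fun h => absurd h hJ⟩
  choose up hup using Hup
  choose dn hdn using Hdn
  let U : ℕ → Finset (Fin n) := fun t => Nat.rec I (fun t J => up (k + t) J) t
  let D : ℕ → Finset (Fin n) := fun t => Nat.rec I (fun t J => dn (k - t) J) t
  have hU : ∀ t, IsCoordBasis (F.spaceNat (k + t)) (U t) := fun t => by
    induction t with
    | zero => exact hI
    | succ t ih => exact (hup _ _ ih).2
  have hD : ∀ t, IsCoordBasis (F.spaceNat (k - t)) (D t) := fun t => by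
    induction t with
    | zero => exact hI
    | succ t ih => exact (hdn _ _ ih).2
  let B : ℕ → Finset (Fin n) := fun j => if j < k then D (k - j) else U (j - k)
  have hB : ∀ j, IsCoordBasis (F.spaceNat j) (B j) := fun j => by
    by_cases hj : j < k
    · have := hD (k - j)
      rw [show k - (k - j) = j by omega] at this
      simpa only [B, if_pos hj] using this
    · have := hU (j - k)
      rw [show k + (j - k) = j by omega] at this
      simpa only [B, if_neg hj] using this
  have hmono : Monotone B := monotone_nat_of_le_succ fun j => by
    by_cases hj : j < k
    · have h1 : B j = dn (k - (k - (j + 1))) (D (k - (j + 1))) := by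
        simp only [B, if_pos hj]
        rw [show k - j = (k - (j + 1)) + 1 by omega]
      have h2 : B (j + 1) = D (k - (j + 1)) := by
        by_cases hj' : j + 1 < k
        · simp only [B, if_pos hj']
        · obtain rfl : k = j + 1 := by omega
          simp [B, U, D]
      rw [h1, h2]
      exact (hdn _ _ (hD _)).1
    · have h1 : B (j + 1) = up (k + (j - k)) (U (j - k)) := by
        simp only [B, if_neg (show ¬ j + 1 < k by omega)]
        rw [show j + 1 - k = (j - k) + 1 by omega]
      have h2 : B j = U (j - k) := by simp only [B, if_neg hj]
      rw [h1, h2]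
      exact (hup _ _ (hU _)).1
  obtain ⟨w, hw⟩ := exists_perm_initialSet_eq hmono fun j hj => by
    rw [(hB j).card_eq, F.finrank_spaceNat hj]
  refine ⟨w, ?_, fun j hj => hw j hj ▸ hB j⟩
  rw [hw k hk]
  simp [B, U]

/-! ### Tilted Richardson varieties in terms of bases -/

theorem cyclicIcc_eq {n : ℕ} (a j : Fin n) :
    cyclicIcc a j = univ.filter fun x => shiftedRank a x ≤ shiftedRank a j := by
  ext x
  simp only [cyclicIcc, mem_filter, mem_univ, true_and, shiftedRank_eq]
  split_ifs <;>
    simp only [mem_Icc, mem_union, mem_Ici, mem_Iic, Fin.le_def] at * <;> omega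

/-- The position of `x` in the order opposite to `≤_r`, counted from `0`. -/
def shiftedCorank {n : ℕ} (r x : Fin n) : ℕ := n - 1 - shiftedRank r x

theorem shiftedCorank_injective {n : ℕ} (r : Fin n) : Function.Injective (shiftedCorank r) := by
  intro x y h
  have h1 := shiftedRank_lt r x
  have h2 := shiftedRank_lt r y
  simp only [shiftedCorank] at h
  exact shiftedRank_injective r (by omega)

theorem cyclicIccPred_eq {n : ℕ} (a j : Fin n) :
    cyclicIccPred j a = univ.filter fun x => shiftedCorank a x ≤ shiftedCorank a j := by
  ext x
  have := x.isLt
  have := j.isLt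
  simp only [cyclicIccPred, mem_filter, mem_univ, true_and, shiftedCorank, shiftedRank_eq]
  split_ifs <;>
    simp only [mem_Ico, mem_union, mem_Ici, mem_Iio, Fin.le_def, Fin.lt_def] at * <;> omega

theorem forall_filter_le_iff {n : ℕ} (ψ : Fin n → ℕ) {P : Finset (Fin n) → Prop} (h0 : P ∅) :
    (∀ j, P (univ.filter fun x => ψ x ≤ ψ j)) ↔ ∀ m, P (univ.filter fun x => ψ x < m) := by
  constructor
  · intro h m
    rcases (univ.filter fun x => ψ x < m).eq_empty_or_nonempty with he | hne
    · rw [he]; exact h0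
    · obtain ⟨j, hj, hmax⟩ := exists_max_image _ ψ hne
      suffices he : (univ.filter fun x => ψ x < m) = univ.filter fun x => ψ x ≤ ψ j from
        he ▸ h j
      ext x
      simp only [mem_filter, mem_univ, true_and] at hj hmax ⊢
      exact ⟨hmax x, fun hx => hx.trans_lt hj⟩
  · intro h j
    simpa only [Nat.lt_succ_iff] using h (ψ j + 1)

theorem projDim_empty {n : ℕ} (V : Submodule ℂ (Fin n → ℂ)) : projDim ∅ V = 0 :=
  projDim_eq_card_iff.2 (indepCoords_empty V)

theorem shiftedGaleLE_iff_rank {n : ℕ} (r : Fin n) {A B : Finset (Fin n)} (h : A.card = B.card) :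
    ShiftedGaleLE r A B ↔ ∀ m, (B ∩ univ.filter fun x => shiftedRank r x < m).card ≤
      (A ∩ univ.filter fun x => shiftedRank r x < m).card := by
  simp only [shiftedGaleLE_iff, h, true_and, inter_filter, inter_univ]

theorem shiftedGaleLE_iff_corank {n : ℕ} (r : Fin n) {A B : Finset (Fin n)}
    (h : A.card = B.card) :
    ShiftedGaleLE r A B ↔ ∀ m, (A ∩ univ.filter fun x => shiftedCorank r x < m).card ≤
      (B ∩ univ.filter fun x => shiftedCorank r x < m).card := by
  have key : ∀ (C : Finset (Fin n)) (m : ℕ), m ≤ n →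
      (C ∩ univ.filter fun x => shiftedRank r x < m).card +
        (C ∩ univ.filter fun x => shiftedCorank r x < n - m).card = C.card := by
    intro C m hm
    simp only [inter_filter, inter_univ]
    rw [← card_filter_add_card_filter_not (s := C) fun x => shiftedRank r x < m]
    congr 2
    ext x
    have := shiftedRank_lt r x
    simp only [mem_filter]
    simp only [shiftedCorank]
    refine and_congr_right fun _ => ?_
    omega
  have hle : ∀ m, (univ.filter fun x : Fin n => shiftedRank r x < m) =
      univ.filter fun x => shiftedRank r x < min m n := fun m => by
    ext x
    have := shiftedRank_lt r x
    simp only [mem_filter, mem_univ, true_and]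
    omega
  have hle' : ∀ m, (univ.filter fun x : Fin n => shiftedCorank r x < m) =
      univ.filter fun x => shiftedCorank r x < n - (n - min m n) := fun m => by
    ext x
    have := shiftedRank_lt r x
    simp only [mem_filter, mem_univ, true_and]
    simp only [shiftedCorank]
    omega
  rw [shiftedGaleLE_iff_rank r h]
  constructor
  · intro H m
    rw [hle']
    have h1 := key A (n - min m n) (Nat.sub_le _ _)
    have h2 := key B (n - min m n) (Nat.sub_le _ _)
    have h3 := H (n - min m n)
    omega
  · intro H m
    rw [hle]
    have h1 := key A (min m n) (min_le_right _ _)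
    have h2 := key B (min m n) (min_le_right _ _)
    have h3 := H (n - min m n)
    omega

/-- The inequalities defining `𝒯_{u,v,𝐚}` say that all bases of `F_k` lie between `u[k]` and `v[k]`
in the shifted Gale order. -/
theorem mem_tiltedRichardson_iff {n : ℕ} {u v : Equiv.Perm (Fin n)} {a : Fin (n - 1) → Fin n}
    {F : CompleteFlag n} :
    F ∈ tiltedRichardson u v a ↔ ∀ (i : Fin (n - 1)) (I : Finset (Fin n)),
      IsCoordBasis (F.step i) I → ShiftedGaleLE (a i) (initialSet u (i + 1)) I ∧
        ShiftedGaleLE (a i) I (initialSet v (i + 1)) := by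
  simp only [tiltedRichardson, Set.mem_ofPred_eq]
  refine forall_congr' fun i => ?_
  simp only [cyclicIcc_eq, cyclicIccPred_eq]
  rw [forall_and,
    forall_filter_le_iff (shiftedRank (a i))
      (P := fun S => projDim S (F.step i) ≤ (initialSet u (i + 1) ∩ S).card)
      (by simp [projDim_empty]),
    forall_filter_le_iff (shiftedCorank (a i))
      (P := fun S => projDim S (F.step i) ≤ (initialSet v (i + 1) ∩ S).card)
      (by simp [projDim_empty])]
  have hcard : ∀ I, IsCoordBasis (F.step i) I → I.card = i + 1 := fun I hI =>
    hI.card_eq.trans (F.finrank_step i)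
  simp only [projDim_le_iff]
  constructor
  · rintro ⟨h1, h2⟩ I hI
    exact ⟨(shiftedGaleLE_iff_rank _ (by rw [card_initialSet_succ, hcard I hI])).2
        fun m => h1 m I hI,
      (shiftedGaleLE_iff_corank _ (by rw [card_initialSet_succ, hcard I hI])).2
        fun m => h2 m I hI⟩
  · intro h
    exact ⟨fun m I hI => (shiftedGaleLE_iff_rank _
        (by rw [card_initialSet_succ, hcard I hI])).1 (h I hI).1 m,
      fun m I hI => (shiftedGaleLE_iff_corank _
        (by rw [card_initialSet_succ, hcard I hI])).1 (h I hI).2 m⟩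

theorem isCoordBasis_of_mem_openTiltedRichardson {n : ℕ} {u v : Equiv.Perm (Fin n)}
    {a : Fin (n - 1) → Fin n} {F : CompleteFlag n} (hF : F ∈ openTiltedRichardson u v a)
    (i : Fin (n - 1)) : IsCoordBasis (F.step i) (initialSet u (i + 1)) ∧
      IsCoordBasis (F.step i) (initialSet v (i + 1)) := by
  have h := hF i
  simp only [cyclicIcc_eq, cyclicIccPred_eq] at h
  rw [forall_and,
    forall_filter_le_iff (shiftedRank (a i))
      (P := fun S => projDim S (F.step i) = (initialSet u (i + 1) ∩ S).card)
      (by simp [projDim_empty]),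
    forall_filter_le_iff (shiftedCorank (a i))
      (P := fun S => projDim S (F.step i) = (initialSet v (i + 1) ∩ S).card)
      (by simp [projDim_empty])] at h
  exact ⟨isCoordBasis_of_projDim_eq (shiftedRank_injective (a i))
      (by rw [card_initialSet_succ, F.finrank_step]) h.1,
    isCoordBasis_of_projDim_eq (shiftedCorank_injective (a i))
      (by rw [card_initialSet_succ, F.finrank_step]) h.2⟩

theorem tiltedRichardson_eq {n : ℕ} {u v : Equiv.Perm (Fin n)} {a : Fin (n - 1) → Fin n}
    (h : SeqLE a u v) : tiltedRichardson u v a =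
      {F : CompleteFlag n | ∀ w, w ∉ tiltedInterval u v → F.pluckerPerm w = 0} := by
  ext F
  rw [mem_tiltedRichardson_iff, Set.mem_ofPred_eq]
  constructor
  · intro hF w hw
    by_contra hne
    rw [← ne_eq, F.pluckerPerm_ne_zero_iff] at hne
    exact hw ((mem_tiltedInterval_iff_seqLE h).2
      ⟨fun i => (hF i _ (hne i)).1, fun i => (hF i _ (hne i)).2⟩)
  · intro hF i I hI
    rw [F.step_eq_spaceNat] at hI
    obtain ⟨w, rfl, hw⟩ := F.exists_perm_of_isCoordBasis (by omega) hI
    have hne : F.pluckerPerm w ≠ 0 := (F.pluckerPerm_ne_zero_iff w).2 fun j => by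
      rw [F.step_eq_spaceNat]
      exact hw _ (by omega)
    have hmem : w ∈ tiltedInterval u v := by
      by_contra hw'
      exact hne (hF w hw')
    have := (mem_tiltedInterval_iff_seqLE h).1 hmem
    exact ⟨this.1 i, this.2 i⟩

theorem openTiltedRichardson_eq {n : ℕ} (u v : Equiv.Perm (Fin n)) (a : Fin (n - 1) → Fin n) :
    openTiltedRichardson u v a = tiltedRichardson u v a ∩
      {F : CompleteFlag n | F.pluckerPerm u * F.pluckerPerm v ≠ 0} := by
  ext F
  constructor
  · intro hF
    refine ⟨fun i j => ⟨(hF i j).1.le, (hF i j).2.le⟩, ?_⟩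
    exact mul_ne_zero
      ((F.pluckerPerm_ne_zero_iff u).2 fun i =>
        (isCoordBasis_of_mem_openTiltedRichardson hF i).1)
      ((F.pluckerPerm_ne_zero_iff v).2 fun i =>
        (isCoordBasis_of_mem_openTiltedRichardson hF i).2)
  · rintro ⟨hF, hne⟩ i j
    rw [Set.mem_ofPred_eq, mul_ne_zero_iff, F.pluckerPerm_ne_zero_iff,
      F.pluckerPerm_ne_zero_iff] at hne
    exact ⟨le_antisymm (hF i j).1 ((hne.1 i).card_inter_le_projDim _),
      le_antisymm (hF i j).2 ((hne.2 i).card_inter_le_projDim _)⟩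

end TiltedRichardson

theorem theorem4p9 (n : ℕ) (u v : Equiv.Perm (Fin n)) :
    (∃ a : Fin (n - 1) → Fin n, SeqLE a u v) ∧
    ∀ a : Fin (n - 1) → Fin n, SeqLE a u v →
      tiltedRichardson u v a =
          {F : CompleteFlag n | ∀ w, w ∉ tiltedInterval u v → F.pluckerPerm w = 0} ∧
        openTiltedRichardson u v a =
          tiltedRichardson u v a ∩
            {F : CompleteFlag n | F.pluckerPerm u * F.pluckerPerm v ≠ 0} := by
  exact ⟨exists_seqLE u v, fun a h => ⟨tiltedRichardson_eq h, openTiltedRichardson_eq u v a⟩⟩
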